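/- **Setting.** Two players play a zero-sum game over a horizon $T$; all spaces of states $\mathcal X_t$, actions $\mathcal U^i_t\neq\emptyset$, observations, private informations $\mathcal P^i_t$ and common-information increments $\mathcal Z_t$ ($i=1,2$) are finite. The state evolves as $X_{t+1}=f_t(X_t,U^1_t,U^2_t,W^s_t)$, the observations are $Y^i_{t+1}=h^i_{t+1}(X_{t+1},U^1_t,U^2_t,W^i_{t+1})$ and $Y^i_1=h^i_1(X_1,W^i_1)$, the private informations evolve as $P^i_{t+1}=\xi^i_{t+1}(P^i_t,U^i_t,Y^i_{t+1})$, and the common information is $C_t=(Z_1,\dots,Z_t)$ with $Z_{t+1}=\zeta_{t+1}(P^1_t,P^2_t,U^1_t,U^2_t,Y^1_{t+1},Y^2_{t+1})$; $Z_1=C_1$ and $P^i_1$ are functions of $(Y^1_1,Y^2_1)$. The variables $X_1,W^s_t,W^1_t,W^2_t$ are finitely valued, and they and the randomization variables $V^1_t,V^2_t$, uniform on $(0,1]$, are all mutually independent. In the expanded virtual game $\mathscr G_e$, player $i$ selects at each time $t$ a prescription $\Gamma^i_t\in\mathcal B^i_t$, i.e. a map $\mathcal P^i_t\to\Delta\mathcal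 U^i_t$, by $\Gamma^i_t=\tilde\chi^i_t(C_t,\Gamma^{1}_{1:t-1},\Gamma^2_{1:t-1})$, where $\tilde\chi^i=(\tilde\chi^i_1,\dots,\tilde\chi^i_T)$ is an arbitrary strategy of this form; the action is $U^i_t=\kappa(\Gamma^i_t(P^i_t),V^i_t)$, where $\kappa(p,V)$ has distribution $p$ for $V$ uniform on $(0,1]$. Let $\mathcal J(\tilde\chi^1,\tilde\chi^2)=\mathbb E\big[\sum_{t=1}^T c_t(X_t,U^1_t,U^2_t)\big]$, which player 1 minimizes and player 2 maximizes, and $$S^u(\mathscr G_e)=\inf_{\tilde\chi^1}\sup_{\tilde\chi^2}\mathcal J(\tilde\chi^1,\tilde\chi^2),\qquad S^l(\mathscr G_e)=\sup_{\tilde\chi^2}\inf_{\tilde\chi^1}\mathcal J(\tilde\chi^1,\tilde\chi^2).$$ For a belief $\pi\in\mathcal S_t:=\Delta(\mathcal X_t\times\mathcal P^1_t\times\mathcal P^2_t)$ and prescriptions $\gamma^i\in\mathcal B^i_t$, write $\gamma^i(p;u)$ for the probability of $u$ under $\gamma^i(p)$ and let $$\tilde c_t(\pi,\gamma^1,\gamma^2)=\sum_{x,p^1,p^2,u^1,u^2}c_t(x,u^1,u^2)\,\pi(x,p^1,p^2)\,\gamma^1(p^1;u^1)\,\gamma^2(p^2;u^2).$$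 Let $P^j_t(\pi,\gamma^1,\gamma^2;\cdot)$ be the joint law of $(Z_{t+1},X_{t+1},P^1_{t+1},P^2_{t+1})$ when $(X_t,P^1_t,P^2_t)$ has law $\pi$ and the prescriptions $\gamma^1,\gamma^2$ are used, and $P^m_t(\pi,\gamma^1,\gamma^2;\cdot)$ its marginal on $Z_{t+1}$. Let $F_t(\pi,\gamma^1,\gamma^2,z)=P^j_t(\pi,\gamma^1,\gamma^2;z,\cdot)/P^m_t(\pi,\gamma^1,\gamma^2;z)\in\mathcal S_{t+1}$ where the denominator is positive, and $F_t=G_t$ elsewhere, for an arbitrary measurable map $G_t$ with values in $\mathcal S_{t+1}$. Let $\Pi_1$ be the conditional distribution of $(X_1,P^1_1,P^2_1)$ given $C_1$ (chosen arbitrarily for values of $C_1$ of probability $0$). For a realization $(c_t,\gamma^{1}_{1:t-1},\gamma^2_{1:t-1})$ of the players' information, the common information belief $\pi_t$ is obtained from $\Pi_1$ by the recursion $\pi_{s+1}=F_s(\pi_s,\gamma^1_s,\gamma^2_s,z_{s+1})$. Let $V^u_{T+1}=V^l_{T+1}=0$ and, for $t=T,\dots,1$ and $\ast\in\{u,l\}$,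 $$w^\ast_t(\pi,\gamma^1,\gamma^2)=\tilde c_t(\pi,\gamma^1,\gamma^2)+\sum_{z}P^m_t(\pi,\gamma^1,\gamma^2;z)\,V^\ast_{t+1}(F_t(\pi,\gamma^1,\gamma^2,z)),$$ $$V^u_t(\pi)=\inf_{\gamma^1}\sup_{\gamma^2}w^u_t(\pi,\gamma^1,\gamma^2),\qquad V^l_t(\pi)=\sup_{\gamma^2}\inf_{\gamma^1}w^l_t(\pi,\gamma^1,\gamma^2).$$ **Theorem.** (a) $S^u(\mathscr G_e)=\mathbb E[V^u_1(\Pi_1)]$ and $S^l(\mathscr G_e)=\mathbb E[V^l_1(\Pi_1)]$. (b) There are measurable maps $\chi^{1*}_t:\mathcal S_t\to\mathcal B^1_t$, $1\le t\le T$, with $V^u_t(\pi)=\max_{\gamma^2}w^u_t(\pi,\chi^{1*}_t(\pi),\gamma^2)$ for all $\pi\in\mathcal S_t$; and for any such maps the strategy $(c_t,\gamma^1_{1:t-1},\gamma^2_{1:t-1})\mapsto\chi^{1*}_t(\pi_t)$ is a min-max strategy of player 1 in $\mathscr G_e$: the supremum of $\mathcal J$ over the strategies of player 2 against it equals $S^u(\mathscr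 G_e)$. (c) There are measurable maps $\chi^{2*}_t:\mathcal S_t\to\mathcal B^2_t$, $1\le t\le T$, with $V^l_t(\pi)=\min_{\gamma^1}w^l_t(\pi,\gamma^1,\chi^{2*}_t(\pi))$ for all $\pi\in\mathcal S_t$; and for any such maps the strategy $(c_t,\gamma^1_{1:t-1},\gamma^2_{1:t-1})\mapsto\chi^{2*}_t(\pi_t)$ is a max-min strategy of player 2 in $\mathscr G_e$: the infimum of $\mathcal J$ over the strategies of player 1 against it equals $S^l(\mathscr G_e)$. -/

import Mathlib

open MeasureTheory ProbabilityTheory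

noncomputable section

/-- The half-open unit interval `(0,1]`, in which the randomization variables take values. -/
abbrev UnitIoc : Type := Set.Ioc (0 : ℝ) 1

/-- The uniform distribution on `(0,1]`. -/
def uniformIoc : Measure UnitIoc := (volume : Measure ℝ).comap Subtype.val

/-- The data of a two-player zero-sum dynamic game with finite spaces and finite horizon `T`.
Players are indexed by `Fin 2` (`0` is the minimizer, `1` is the maximizer).  Time starts at `0`,
so that the decision times are `0, …, T - 1`; everything at later times plays no role. -/
structure GameModel where
  /-- horizon -/
  T : ℕ
  /-- states -/
  X : ℕ → Type
  /-- actions -/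
  U : Fin 2 → ℕ → Type
  /-- observations -/
  Y : Fin 2 → ℕ → Type
  /-- private informations -/
  P : Fin 2 → ℕ → Type
  /-- increments of the common information -/
  Z : ℕ → Type
  /-- system noise -/
  Ws : ℕ → Type
  /-- observation noises -/
  W : Fin 2 → ℕ → Type
  fintypeX : ∀ t, Fintype (X t)
  fintypeU : ∀ i t, Fintype (U i t)
  nonemptyU : ∀ i t, Nonempty (U i t)
  fintypeY : ∀ i t, Fintype (Y i t)
  fintypeP : ∀ i t, Fintype (P i t)
  fintypeZ : ∀ t, Fintype (Z t)
  fintypeWs : ∀ t, Fintype (Ws t)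
  fintypeW : ∀ i t, Fintype (W i t)
  /-- state dynamics `X_{t+1} = f_t (X_t, U_t^1, U_t^2, W_t^s)` -/
  f : ∀ t, X t → U 0 t → U 1 t → Ws t → X (t + 1)
  /-- initial observations (there is no earlier action) -/
  h₀ : ∀ i, X 0 → W i 0 → Y i 0
  /-- later observations `Y_{t+1}^i = h_{t+1}^i (X_{t+1}, U_t^1, U_t^2, W_{t+1}^i)` -/
  h : ∀ i t, X (t + 1) → U 0 t → U 1 t → W i (t + 1) → Y i (t + 1)
  /-- initial common information -/
  ζ₀ : Y 0 0 → Y 1 0 → Z 0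
  /-- increment `Z_{t+1} = ζ_{t+1} (P_t^{1:2}, U_t^{1:2}, Y_{t+1}^{1:2})` -/
  ζ : ∀ t, P 0 t → P 1 t → U 0 t → U 1 t → Y 0 (t + 1) → Y 1 (t + 1) → Z (t + 1)
  /-- initial private informations -/
  ξ₀ : ∀ i, Y 0 0 → Y 1 0 → P i 0
  /-- update `P_{t+1}^i = ξ_{t+1}^i (P_t^i, U_t^i, Y_{t+1}^i)` -/
  ξ : ∀ i t, P i t → U i t → Y i (t + 1) → P i (t + 1)
  /-- stage costs -/
  c : ∀ t, X t → U 0 t → U 1 t → ℝ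
  /-- the randomization mechanism: `κ p V` has distribution `p` if `V` is uniform on `(0,1]` -/
  κ : ∀ i t, stdSimplex ℝ (U i t) → UnitIoc → U i t
  measurableSet_κ : ∀ i t (p : stdSimplex ℝ (U i t)) (u : U i t), MeasurableSet {v | κ i t p v = u}
  volume_κ : ∀ i t (p : stdSimplex ℝ (U i t)) (u : U i t),
    uniformIoc {v | κ i t p v = u} = ENNReal.ofReal (p.1 u)

attribute [instance] GameModel.fintypeX GameModel.fintypeU GameModel.nonemptyU GameModel.fintypeY
  GameModel.fintypeP GameModel.fintypeZ GameModel.fintypeWs GameModel.fintypeW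

/-- Bayes normalization: `q / ∑ q` if the total mass of the nonnegative function `q` is positive,
and `g` otherwise. -/
def bayes {α : Type} [Fintype α] (q : α → ℝ) (hq : ∀ a, 0 ≤ q a) (g : stdSimplex ℝ α) :
    stdSimplex ℝ α :=
  open Classical in
  if h : 0 < ∑ a, q a then
    ⟨fun a => q a / ∑ b, q b, fun a => div_nonneg (hq a) h.le, by
      rw [← Finset.sum_div]; exact div_self h.ne'⟩
  else g

namespace GameModel

variable (M : GameModel)

/-- Prescriptions of virtual player `i` at time `t`: maps from private information to
distributions over actions. -/
abbrev Prescription (i : Fin 2) (t : ℕ) : Type := M.P i t → stdSimplex ℝ (M.U i t)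

/-- Beliefs on the state and on the private informations at time `t`. -/
abbrev Belief (t : ℕ) : Type := stdSimplex ℝ (M.X t × M.P 0 t × M.P 1 t)

/-- Realizations of the information of the virtual players in the expanded game at time `t`: the
common information (the sequence of its increments up to time `t`) together with the prescriptions
of both players before time `t`. -/
inductive Hist : ℕ → Type
  | start (z : M.Z 0) : Hist 0
  | step {t : ℕ} (k : Hist t) (γ₁ : M.Prescription 0 t) (γ₂ : M.Prescription 1 t)
      (z : M.Z (t + 1)) : Hist (t + 1)

/-- Control strategies of virtual player `i` in the expanded game. -/
abbrev Strategy (i : Fin 2) : Type := ∀ t, M.Hist t → M.Prescription i t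

/-- Labels of the random variables that drive the game up to the horizon. -/
inductive PrimIdx (T : ℕ) : Type
  | x₀ : PrimIdx T
  | ws (t : Fin T) : PrimIdx T
  | w (i : Fin 2) (t : Fin T) : PrimIdx T
  | v (i : Fin 2) (t : Fin T) : PrimIdx T

/-- The value spaces of these random variables. -/
def PrimVal : PrimIdx M.T → Type
  | .x₀ => M.X 0
  | .ws t => M.Ws t
  | .w i t => M.W i t
  | .v _ _ => UnitIoc

instance instMeasurableSpacePrimVal : ∀ k, MeasurableSpace (M.PrimVal k)
  | .x₀ => ⊤
  | .ws _ => ⊤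
  | .w _ _ => ⊤
  | .v _ _ => inferInstanceAs (MeasurableSpace UnitIoc)

/-- The random variables that drive the game, as one family. -/
def primRV {M : GameModel} {Ω : Type*} (X₀ : Ω → M.X 0) (Ws : ∀ t, Ω → M.Ws t)
    (W : ∀ i t, Ω → M.W i t) (V : Fin 2 → ℕ → Ω → UnitIoc) : ∀ k, Ω → M.PrimVal k
  | .x₀ => X₀
  | .ws t => Ws t
  | .w i t => W i t
  | .v i t => V i t

/-- The primitive random variables (initial state, system noise, observation noises) and the
randomization variables, which are uniform on `(0,1]`; all of them are mutually independent. -/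
structure Primitives {Ω : Type*} [MeasurableSpace Ω] (μ : Measure Ω) where
  X₀ : Ω → M.X 0
  Ws : ∀ t, Ω → M.Ws t
  W : ∀ i t, Ω → M.W i t
  V : Fin 2 → ℕ → Ω → UnitIoc
  measurable_primRV : ∀ k, Measurable (primRV X₀ Ws W V k)
  indep : iIndepFun (primRV X₀ Ws W V) μ
  uniform : ∀ (i : Fin 2) (t : Fin M.T), μ.map (V i t) = uniformIoc

/-- What has happened before the decisions at time `t`: state, private informations, and the
information of the virtual players. -/
structure Snapshot (t : ℕ) where
  x : M.X t
  p₁ : M.P 0 t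
  p₂ : M.P 1 t
  hist : M.Hist t

namespace Primitives

variable {M} {Ω : Type*} [MeasurableSpace Ω] {μ : Measure Ω} (R : M.Primitives μ)

/-- The initial snapshot, without the strategies. -/
def initial (ω : Ω) : M.X 0 × M.P 0 0 × M.P 1 0 :=
  let y₁ := M.h₀ 0 (R.X₀ ω) (R.W 0 0 ω)
  let y₂ := M.h₀ 1 (R.X₀ ω) (R.W 1 0 ω)
  (R.X₀ ω, M.ξ₀ 0 y₁ y₂, M.ξ₀ 1 y₁ y₂)

/-- The initial common information. -/
def initialCommon (ω : Ω) : M.Z 0 :=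
  M.ζ₀ (M.h₀ 0 (R.X₀ ω) (R.W 0 0 ω)) (M.h₀ 1 (R.X₀ ω) (R.W 1 0 ω))

/-- One step of the uncontrolled part of the dynamics: from the state, private informations and
actions at time `t` to the increment of common information, the state and the private informations
at time `t + 1`. -/
def next (t : ℕ) (x : M.X t) (p₁ : M.P 0 t) (p₂ : M.P 1 t) (u₁ : M.U 0 t) (u₂ : M.U 1 t) (ω : Ω) :
    M.Z (t + 1) × M.X (t + 1) × M.P 0 (t + 1) × M.P 1 (t + 1) :=
  let x' := M.f t x u₁ u₂ (R.Ws t ω)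
  let y₁ := M.h 0 t x' u₁ u₂ (R.W 0 (t + 1) ω)
  let y₂ := M.h 1 t x' u₁ u₂ (R.W 1 (t + 1) ω)
  (M.ζ t p₁ p₂ u₁ u₂ y₁ y₂, x', M.ξ 0 t p₁ u₁ y₁, M.ξ 1 t p₂ u₂ y₂)

/-- The expanded game under the strategy profile `(χ₁, χ₂)`. -/
def process (χ₁ : M.Strategy 0) (χ₂ : M.Strategy 1) (ω : Ω) : ∀ t, M.Snapshot t
  | 0 => ⟨(R.initial ω).1, (R.initial ω).2.1, (R.initial ω).2.2, .start (R.initialCommon ω)⟩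
  | t + 1 =>
    let s := process χ₁ χ₂ ω t
    let γ₁ := χ₁ t s.hist
    let γ₂ := χ₂ t s.hist
    let u₁ := M.κ 0 t (γ₁ s.p₁) (R.V 0 t ω)
    let u₂ := M.κ 1 t (γ₂ s.p₂) (R.V 1 t ω)
    let n := R.next t s.x s.p₁ s.p₂ u₁ u₂ ω
    ⟨n.2.1, n.2.2.1, n.2.2.2, .step s.hist γ₁ γ₂ n.1⟩

/-- The action of player 1 at time `t`. -/
def action₁ (χ₁ : M.Strategy 0) (χ₂ : M.Strategy 1) (t : ℕ) (ω : Ω) : M.U 0 t :=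
  let s := R.process χ₁ χ₂ ω t
  M.κ 0 t (χ₁ t s.hist s.p₁) (R.V 0 t ω)

/-- The action of player 2 at time `t`. -/
def action₂ (χ₁ : M.Strategy 0) (χ₂ : M.Strategy 1) (t : ℕ) (ω : Ω) : M.U 1 t :=
  let s := R.process χ₁ χ₂ ω t
  M.κ 1 t (χ₂ t s.hist s.p₂) (R.V 1 t ω)

/-- The total expected cost of a strategy profile. -/
def cost (χ₁ : M.Strategy 0) (χ₂ : M.Strategy 1) : ℝ :=
  ∫ ω, ∑ t ∈ Finset.range M.T,
    M.c t (R.process χ₁ χ₂ ω t).x (R.action₁ χ₁ χ₂ t ω) (R.action₂ χ₁ χ₂ t ω) ∂μ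

/-- The upper value of the expanded game. -/
def upperValue : EReal := ⨅ χ₁ : M.Strategy 0, ⨆ χ₂ : M.Strategy 1, (R.cost χ₁ χ₂ : EReal)

/-- The lower value of the expanded game. -/
def lowerValue : EReal := ⨆ χ₂ : M.Strategy 1, ⨅ χ₁ : M.Strategy 0, (R.cost χ₁ χ₂ : EReal)

/-- A min-max strategy of player 1: its guaranteed cost is the upper value. -/
def IsMinMaxStrategy (χ₁ : M.Strategy 0) : Prop :=
  (⨆ χ₂ : M.Strategy 1, (R.cost χ₁ χ₂ : EReal)) = R.upperValue

/-- A max-min strategy of player 2: its guaranteed cost is the lower value. -/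
def IsMaxMinStrategy (χ₂ : M.Strategy 1) : Prop :=
  (⨅ χ₁ : M.Strategy 0, (R.cost χ₁ χ₂ : EReal)) = R.lowerValue

/-- The transition probability
`ℙ[z_{t+1}, x_{t+1}, p_{t+1}^{1:2} | x_t, p_t^{1:2}, u_t^{1:2}]` given by the system dynamics. -/
def transition (t : ℕ) (x : M.X t) (p₁ : M.P 0 t) (p₂ : M.P 1 t) (u₁ : M.U 0 t) (u₂ : M.U 1 t)
    (z : M.Z (t + 1)) (a : M.X (t + 1) × M.P 0 (t + 1) × M.P 1 (t + 1)) : ℝ :=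
  μ.real {ω | R.next t x p₁ p₂ u₁ u₂ ω = (z, a)}

/-- The joint distribution of `Z_{t+1}, X_{t+1}, P_{t+1}^{1:2}` if `X_t, P_t^{1:2}` have
distribution `π` and the prescriptions `γ₁, γ₂` are used. -/
def joint (t : ℕ) (π : M.Belief t) (γ₁ : M.Prescription 0 t) (γ₂ : M.Prescription 1 t)
    (z : M.Z (t + 1)) (a : M.X (t + 1) × M.P 0 (t + 1) × M.P 1 (t + 1)) : ℝ :=
  ∑ x : M.X t, ∑ p₁ : M.P 0 t, ∑ p₂ : M.P 1 t, ∑ u₁ : M.U 0 t, ∑ u₂ : M.U 1 t,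
    π.1 (x, p₁, p₂) * (γ₁ p₁).1 u₁ * (γ₂ p₂).1 u₂ * R.transition t x p₁ p₂ u₁ u₂ z a

lemma joint_nonneg (t : ℕ) (π : M.Belief t) (γ₁ : M.Prescription 0 t) (γ₂ : M.Prescription 1 t)
    (z : M.Z (t + 1)) (a : M.X (t + 1) × M.P 0 (t + 1) × M.P 1 (t + 1)) :
    0 ≤ R.joint t π γ₁ γ₂ z a := by
  unfold joint transition
  refine Finset.sum_nonneg fun x _ => Finset.sum_nonneg fun p₁ _ => Finset.sum_nonneg fun p₂ _ =>
    Finset.sum_nonneg fun u₁ _ => Finset.sum_nonneg fun u₂ _ => ?_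
  exact mul_nonneg (mul_nonneg (mul_nonneg (π.2.1 _) ((γ₁ p₁).2.1 _)) ((γ₂ p₂).2.1 _))
    measureReal_nonneg

/-- The marginal distribution of `Z_{t+1}`. -/
def marginal (t : ℕ) (π : M.Belief t) (γ₁ : M.Prescription 0 t) (γ₂ : M.Prescription 1 t)
    (z : M.Z (t + 1)) : ℝ :=
  ∑ a, R.joint t π γ₁ γ₂ z a

end Primitives

/-- The arbitrary values of beliefs given events of probability zero: at the initial time, and in
the belief update, where they depend measurably on the belief and on the prescriptions. -/
structure Fallback where
  G₀ : M.Z 0 → M.Belief 0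
  G : ∀ t, M.Belief t → M.Prescription 0 t → M.Prescription 1 t → M.Z (t + 1) → M.Belief (t + 1)
  measurable_G : ∀ t (z : M.Z (t + 1)),
    Measurable fun q : M.Belief t × M.Prescription 0 t × M.Prescription 1 t => G t q.1 q.2.1 q.2.2 z

/-- The expected stage cost for a belief and a pair of prescriptions. -/
def stageCost (t : ℕ) (π : M.Belief t) (γ₁ : M.Prescription 0 t) (γ₂ : M.Prescription 1 t) : ℝ :=
  ∑ x : M.X t, ∑ p₁ : M.P 0 t, ∑ p₂ : M.P 1 t, ∑ u₁ : M.U 0 t, ∑ u₂ : M.U 1 t,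
    M.c t x u₁ u₂ * π.1 (x, p₁, p₂) * (γ₁ p₁).1 u₁ * (γ₂ p₂).1 u₂

namespace Primitives

variable {M} {Ω : Type*} [MeasurableSpace Ω] {μ : Measure Ω} (R : M.Primitives μ)
  (K : M.Fallback)

/-- The belief update `F_t`. -/
def update (t : ℕ) (π : M.Belief t) (γ₁ : M.Prescription 0 t) (γ₂ : M.Prescription 1 t)
    (z : M.Z (t + 1)) : M.Belief (t + 1) :=
  bayes (R.joint t π γ₁ γ₂ z) (R.joint_nonneg t π γ₁ γ₂ z) (K.G t π γ₁ γ₂ z)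

/-- The conditional distribution of the initial state and private informations, given that the
initial common information is `z`. -/
def initialBelief (z : M.Z 0) : M.Belief 0 :=
  bayes (fun a => μ.real {ω | R.initial ω = a ∧ R.initialCommon ω = z})
    (fun _ => measureReal_nonneg) (K.G₀ z)

/-- The common information belief for a realization of the information of the virtual players,
computed recursively by the belief update. -/
def belief : ∀ {t : ℕ}, M.Hist t → M.Belief t
  | _, .start z => R.initialBelief K z
  | _, .step (t := t) k γ₁ γ₂ z => R.update K t (belief k) γ₁ γ₂ z

/-- The initial common information belief, as a random variable. -/
def initialCIB (ω : Ω) : M.Belief 0 := R.initialBelief K (R.initialCommon ω)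

/-- Expected stage cost plus the expected value of `V` at the next belief. -/
def stageValue (t : ℕ) (V : M.Belief (t + 1) → ℝ) (π : M.Belief t) (γ₁ : M.Prescription 0 t)
    (γ₂ : M.Prescription 1 t) : ℝ :=
  M.stageCost t π γ₁ γ₂ + ∑ z, R.marginal t π γ₁ γ₂ z * V (R.update K t π γ₁ γ₂ z)

/-- The min-max dynamic program started at time `t` with `n` remaining stages. -/
def minMaxDP : ∀ (n t : ℕ), M.Belief t → ℝ
  | 0, _, _ => 0
  | n + 1, t, π => ⨅ γ₁, ⨆ γ₂, R.stageValue K t (minMaxDP n (t + 1)) π γ₁ γ₂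

/-- The max-min dynamic program started at time `t` with `n` remaining stages. -/
def maxMinDP : ∀ (n t : ℕ), M.Belief t → ℝ
  | 0, _, _ => 0
  | n + 1, t, π => ⨆ γ₂, ⨅ γ₁, R.stageValue K t (maxMinDP n (t + 1)) π γ₁ γ₂

/-- The value function `V_t^u` of the min-max dynamic program. -/
def Vu (t : ℕ) : M.Belief t → ℝ := R.minMaxDP K (M.T - t) t

/-- The value function `V_t^l` of the max-min dynamic program. -/
def Vl (t : ℕ) : M.Belief t → ℝ := R.maxMinDP K (M.T - t) t

/-- The function `w_t^u` of the min-max dynamic program. -/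
def wu (t : ℕ) : M.Belief t → M.Prescription 0 t → M.Prescription 1 t → ℝ :=
  R.stageValue K t (R.Vu K (t + 1))

/-- The function `w_t^l` of the max-min dynamic program. -/
def wl (t : ℕ) : M.Belief t → M.Prescription 0 t → M.Prescription 1 t → ℝ :=
  R.stageValue K t (R.Vl K (t + 1))

/-- Measurable minimax selectors: `V_t^u(π) = max_{γ₂} w_t^u(π, σ_t(π), γ₂)`. -/
def IsMinMaxSelector (σ : ∀ t, M.Belief t → M.Prescription 0 t) : Prop :=
  ∀ t < M.T, Measurable (σ t) ∧
    ∀ π, IsGreatest (Set.range fun γ₂ => R.wu K t π (σ t π) γ₂) (R.Vu K t π)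

/-- Measurable maximin selectors: `V_t^l(π) = min_{γ₁} w_t^l(π, γ₁, σ_t(π))`. -/
def IsMaxMinSelector (σ : ∀ t, M.Belief t → M.Prescription 1 t) : Prop :=
  ∀ t < M.T, Measurable (σ t) ∧
    ∀ π, IsLeast (Set.range fun γ₁ => R.wl K t π γ₁ (σ t π)) (R.Vl K t π)

/-- The strategy in the expanded game that applies a selector to the common information belief. -/
def beliefStrategy {i : Fin 2} (σ : ∀ t, M.Belief t → M.Prescription i t) : M.Strategy i :=
  fun t k => σ t (R.belief K k)

end Primitives

end GameModel

end

/-! The histories contain the prescriptions of both players, so the recursion `belief` involves no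
strategy; under every profile it yields the conditional law of state and private informations given
the history (`isFilter`). Expected stage costs and transitions are thus functions of the belief and
the current prescriptions. Telescoping then gives, for any functions `V t` of the belief with `V M.T
= 0`, that the cost is the mean of `V 0` at the initial belief plus the means of the one-stage
defects `stageValue (V (t + 1)) - V t` (`cost_eq`).

Take `V = Vu`. A min-max selector makes every defect nonpositive, whatever player 2 does.
Conversely, against any strategy of player 1, a reply chosen at each history makes every defect
nonnegative. This identifies the upper value and shows that selectors attain it; the lower value is
symmetric.

Two points need care. Selectors exist because the value functions are continuous: the belief update
can jump only where its weight `marginal` vanishes (`continuous_marginal_mul`); compactness then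
gives measurable minimizers (`exists_measurable_minimizer`). Strategies are arbitrary maps, but a
fixed profile produces only finitely many histories before the horizon (`isFiniteRV_process`), so
these expectations are finite sums. -/

/-! ### Min-max and measurable selection over compact spaces -/

section Selection

variable {S A B : Type*} [TopologicalSpace S]

/-- A jointly continuous function on `S × A`, with `A` compact metrizable, has a measurable
selection of minimizers. -/
theorem exists_measurable_minimizer [MeasurableSpace S] [OpensMeasurableSpace S]
    [MetricSpace A] [CompactSpace A] [Nonempty A] [MeasurableSpace A] [BorelSpace A]
    {g : S → A → ℝ} (hg : Continuous fun q : S × A => g q.1 q.2) :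
    ∃ σ : S → A, Measurable σ ∧ ∀ s a, g s (σ s) ≤ g s a := by
  -- Parametrizing `A` by the Cantor set, a compact subset of the line, allows a canonical choice:
  -- the least parameter of a minimizer.
  obtain ⟨f, hf, hfs⟩ := exists_nat_bool_continuous_surjective_of_compact A
  set φ : cantorSet → A := fun k => f (cantorSetHomeomorphNatToBool k) with hφ
  have hφc : Continuous φ := hf.comp cantorSetHomeomorphNatToBool.continuous
  have hφs : Function.Surjective φ := hfs.comp cantorSetHomeomorphNatToBool.surjective
  have : CompactSpace cantorSet := isCompact_iff_compactSpace.1 isCompact_cantorSet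
  have : Nonempty cantorSet := ⟨cantorSetHomeomorphNatToBool.symm fun _ => false⟩
  have hgφ : Continuous fun q : S × cantorSet => g q.1 (φ q.2) :=
    hg.comp (continuous_fst.prodMk (hφc.comp continuous_snd))
  have hmin : ∀ s, IsClosed {k : cantorSet | ∀ k', g s (φ k) ≤ g s (φ k')} := fun s => by
    simp only [Set.ofPred_forall]
    exact isClosed_iInter fun k' => isClosed_le
      (hgφ.comp (continuous_const.prodMk continuous_id)) continuous_const
  have hne : ∀ s, ∃ k : cantorSet, ∀ k', g s (φ k) ≤ g s (φ k') := fun s => by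
    obtain ⟨k, -, hk⟩ := isCompact_univ.exists_isMinOn (Set.univ_nonempty (α := cantorSet))
      (hgφ.comp (continuous_const.prodMk continuous_id) :
        Continuous fun k => g s (φ k)).continuousOn
    exact ⟨k, fun k' => hk (Set.mem_univ k')⟩
  have hleast : ∀ s, ∃ k : cantorSet, (∀ k', g s (φ k) ≤ g s (φ k')) ∧
      ∀ l : cantorSet, (∀ k', g s (φ l) ≤ g s (φ k')) → (k : ℝ) ≤ l := fun s => by
    obtain ⟨k, hk, hk'⟩ := (hmin s).isCompact.exists_isMinOn (hne s)
      continuous_subtype_val.continuousOn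
    exact ⟨k, hk, fun l hl => hk' hl⟩
  choose κ hκ hκl using hleast
  refine ⟨fun s => φ (κ s), hφc.measurable.comp ?_, fun s a => ?_⟩
  · have hval : Measurable fun s => (κ s : ℝ) := by
      refine measurable_of_Iic fun c => ?_
      have hC₁ : IsClosed {q : S × cantorSet | (q.2 : ℝ) ≤ c} :=
        isClosed_le (continuous_subtype_val.comp continuous_snd) continuous_const
      have hC₂ : IsClosed {q : S × cantorSet | ∀ k', g q.1 (φ q.2) ≤ g q.1 (φ k')} := by
        simp only [Set.ofPred_forall]
        exact isClosed_iInter fun k' => isClosed_le hgφ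
          (hgφ.comp (continuous_fst.prodMk continuous_const))
      -- Since `κ s` is the least minimizing parameter, `κ s ≤ c` means that some minimizing
      -- parameter is at most `c`. The sublevel set is therefore the projection of a closed set
      -- along a compact factor, hence closed.
      convert (isClosedMap_fst_of_compactSpace _ (hC₁.inter hC₂)).measurableSet using 1
      ext s
      constructor
      · intro h
        exact ⟨(s, κ s), ⟨h, hκ s⟩, rfl⟩
      · rintro ⟨⟨s', k⟩, ⟨h1, h2⟩, rfl⟩
        exact (hκl s' k h2).trans h1
    exact hval.subtype_mk
  · obtain ⟨k, rfl⟩ := hφs a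
    exact hκ s k

theorem continuous_iSup_of_compact [TopologicalSpace B] [CompactSpace B] {g : S → B → ℝ}
    (hg : Continuous fun q : S × B => g q.1 q.2) : Continuous fun s => ⨆ b, g s b := by
  have := isCompact_univ.continuous_sSup (K := (Set.univ : Set B)) (f := g) hg
  simpa only [Set.image_univ, iSup, iInf] using this

theorem isGreatest_range_iSup [TopologicalSpace B] [CompactSpace B] [Nonempty B] {g : B → ℝ}
    (hg : Continuous g) : IsGreatest (Set.range g) (⨆ b, g b) :=
  (isCompact_range hg).isGreatest_sSup (Set.range_nonempty g)

theorem isLeast_range_iInf [TopologicalSpace B] [CompactSpace B] [Nonempty B] {g : B → ℝ}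
    (hg : Continuous g) : IsLeast (Set.range g) (⨅ b, g b) :=
  (isCompact_range hg).isLeast_sInf (Set.range_nonempty g)

theorem continuous_iInf_of_compact [TopologicalSpace B] [CompactSpace B] {g : S → B → ℝ}
    (hg : Continuous fun q : S × B => g q.1 q.2) : Continuous fun s => ⨅ b, g s b := by
  have := isCompact_univ.continuous_sInf (K := (Set.univ : Set B)) (f := g) hg
  simpa only [Set.image_univ, iSup, iInf] using this

variable [TopologicalSpace A] [TopologicalSpace B] [CompactSpace B] {w : S → A → B → ℝ}

theorem continuous_iSup_right (hw : Continuous fun q : S × A × B => w q.1 q.2.1 q.2.2) :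
    Continuous fun q : S × A => ⨆ b, w q.1 q.2 b :=
  continuous_iSup_of_compact (g := fun (q : S × A) b => w q.1 q.2 b)
    (hw.comp ((continuous_fst.comp continuous_fst).prodMk
      ((continuous_snd.comp continuous_fst).prodMk continuous_snd)))

theorem continuous_minMax [CompactSpace A] (hw : Continuous fun q : S × A × B => w q.1 q.2.1 q.2.2) :
    Continuous fun s => ⨅ a, ⨆ b, w s a b :=
  continuous_iInf_of_compact (g := fun s a => ⨆ b, w s a b) (continuous_iSup_right hw)

/-- By compactness a best reply to `a` exists exactly, so no error terms have to be carried through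
the stages. -/
theorem exists_minMax_le [CompactSpace A] [Nonempty B]
    (hw : Continuous fun q : S × A × B => w q.1 q.2.1 q.2.2)
    (s : S) (a : A) : ∃ b, ⨅ a, ⨆ b, w s a b ≤ w s a b := by
  have : Nonempty A := ⟨a⟩
  obtain ⟨b, hb⟩ := (isGreatest_range_iSup (g := fun b => w s a b)
    (hw.comp (by fun_prop : Continuous fun b => (s, a, b)))).1
  refine ⟨b, ?_⟩
  rw [show w s a b = ⨆ b, w s a b from hb]
  exact (isLeast_range_iInf (g := fun a => ⨆ b, w s a b)
    ((continuous_iSup_right hw).comp (by fun_prop : Continuous fun a => (s, a)))).2 ⟨a, rfl⟩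

/-- Exchanging the players and the sign of the payoff reduces max-min facts to min-max facts. No
boundedness is needed: in `ℝ` the supremum of `-s` is minus the infimum of `s` for every set,
default values included. -/
theorem neg_iInf_iSup_neg {A B : Type*} (w : A → B → ℝ) :
    -(⨅ a, ⨆ b, -w a b) = ⨆ a, ⨅ b, w a b := by
  have h1 : ∀ a, ⨆ b, -w a b = -⨅ b, w a b := fun a => by
    rw [iSup, iInf, ← Real.sSup_neg]
    congr 1
    ext x
    simp [neg_eq_iff_eq_neg]
  simp only [h1]
  rw [iSup, iInf, ← Real.sSup_neg]
  congr 1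
  ext x
  simp 

end Selection

section Selection

variable {S A B : Type*} [TopologicalSpace S] [MeasurableSpace S] [OpensMeasurableSpace S]
  [MetricSpace A] [CompactSpace A] [Nonempty A] [MeasurableSpace A] [BorelSpace A]
  [TopologicalSpace B] [CompactSpace B] [Nonempty B] {w : S → A → B → ℝ}

/-- Measurable selection of minimax points. -/
theorem exists_measurable_minMax (hw : Continuous fun q : S × A × B => w q.1 q.2.1 q.2.2) :
    ∃ σ : S → A, Measurable σ ∧
      ∀ s, IsGreatest (Set.range fun b => w s (σ s) b) (⨅ a, ⨆ b, w s a b) := by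
  obtain ⟨σ, hσ, hmin⟩ := exists_measurable_minimizer (g := fun s a => ⨆ b, w s a b) (continuous_iSup_right hw)
  refine ⟨σ, hσ, fun s => ?_⟩
  -- The infimum is attained at `σ s`, which also supplies the lower bound required by `ciInf_le`.
  have h : ⨅ a, ⨆ b, w s a b = ⨆ b, w s (σ s) b :=
    le_antisymm (ciInf_le ⟨_, Set.forall_mem_range.2 (hmin s)⟩ _) (le_ciInf (hmin s))
  rw [h]
  exact isGreatest_range_iSup (hw.comp (by fun_prop : Continuous fun b => (s, σ s, b)))

end Selection

/-! ### Continuity of the dynamic programs and existence of selectors -/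

/-- Bayes' rule without division. If the total mass is zero, then `q` vanishes by nonnegativity, and
the fallback `g` is multiplied by zero. -/
theorem sum_mul_bayes {α : Type} [Fintype α] (q : α → ℝ) (hq : ∀ a, 0 ≤ q a)
    (g : stdSimplex ℝ α) (a : α) : (∑ b, q b) * (bayes q hq g).1 a = q a := by
  unfold bayes
  split_ifs with h
  · exact mul_div_cancel₀ _ h.ne'
  · have h0 := le_antisymm (not_lt.1 h) (Finset.sum_nonneg fun a _ => hq a)
    rw [h0, zero_mul, (Finset.sum_eq_zero_iff_of_nonneg fun a _ => hq a).1 h0 a (Finset.mem_univ a)]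

namespace GameModel.Primitives

variable {M : GameModel} {Ω : Type*} [MeasurableSpace Ω] {μ : Measure Ω} (R : M.Primitives μ)
  (K : M.Fallback)

theorem marginal_mul_update (t : ℕ) (π : M.Belief t) (γ₁ : M.Prescription 0 t)
    (γ₂ : M.Prescription 1 t) (z : M.Z (t + 1)) (a) :
    R.marginal t π γ₁ γ₂ z * (R.update K t π γ₁ γ₂ z).1 a = R.joint t π γ₁ γ₂ z a :=
  sum_mul_bayes _ _ _ a

theorem continuous_weight (t : ℕ) (x : M.X t) (p₁ : M.P 0 t) (p₂ : M.P 1 t) (u₁ : M.U 0 t)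
    (u₂ : M.U 1 t) :
    Continuous fun q : M.Belief t × M.Prescription 0 t × M.Prescription 1 t =>
      q.1.1 (x, p₁, p₂) * (q.2.1 p₁).1 u₁ * (q.2.2 p₂).1 u₂ := by
  refine Continuous.mul (Continuous.mul ?_ ?_) ?_
  · exact (continuous_apply _).comp (continuous_subtype_val.comp continuous_fst)
  · exact (continuous_apply _).comp (continuous_subtype_val.comp
      ((continuous_apply p₁).comp (continuous_fst.comp continuous_snd)))
  · exact (continuous_apply _).comp (continuous_subtype_val.comp
      ((continuous_apply p₂).comp (continuous_snd.comp continuous_snd)))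

theorem continuous_joint (t : ℕ) (z : M.Z (t + 1)) (a) :
    Continuous fun q : M.Belief t × M.Prescription 0 t × M.Prescription 1 t =>
      R.joint t q.1 q.2.1 q.2.2 z a := by
  unfold joint
  exact continuous_finsetSum _ fun x _ => continuous_finsetSum _ fun p₁ _ =>
    continuous_finsetSum _ fun p₂ _ => continuous_finsetSum _ fun u₁ _ =>
    continuous_finsetSum _ fun u₂ _ => (continuous_weight t x p₁ p₂ u₁ u₂).mul continuous_const

theorem continuous_marginal (t : ℕ) (z : M.Z (t + 1)) :
    Continuous fun q : M.Belief t × M.Prescription 0 t × M.Prescription 1 t =>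
      R.marginal t q.1 q.2.1 q.2.2 z :=
  continuous_finsetSum _ fun a _ => R.continuous_joint t z a

-- Where the marginal is positive, the update is a quotient of continuous functions. Where it
-- vanishes, the update may jump, but `V` is bounded on the compact simplex and the product is
-- squeezed to zero.
open Topology Filter in
theorem continuous_marginal_mul (t : ℕ) (z : M.Z (t + 1)) {V : M.Belief (t + 1) → ℝ}
    (hV : Continuous V) :
    Continuous fun q : M.Belief t × M.Prescription 0 t × M.Prescription 1 t =>
      R.marginal t q.1 q.2.1 q.2.2 z * V (R.update K t q.1 q.2.1 q.2.2 z) := by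
  have hm := R.continuous_marginal t z
  have hnn : ∀ q : M.Belief t × M.Prescription 0 t × M.Prescription 1 t,
      0 ≤ R.marginal t q.1 q.2.1 q.2.2 z := fun q =>
    Finset.sum_nonneg fun a _ => R.joint_nonneg t q.1 q.2.1 q.2.2 z a
  rw [continuous_iff_continuousAt]
  intro q
  rcases (hnn q).eq_or_lt with h0 | hpos
  · obtain ⟨C, hC⟩ := (isCompact_range hV).isBounded.exists_norm_le
    have hlim : Tendsto (fun q : M.Belief t × M.Prescription 0 t × M.Prescription 1 t =>
        R.marginal t q.1 q.2.1 q.2.2 z * C) (𝓝 q) (𝓝 0) := by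
      have := (hm.tendsto q).mul_const C
      rwa [← h0, zero_mul] at this
    rw [ContinuousAt, ← h0, zero_mul]
    refine squeeze_zero_norm (fun q' => ?_) hlim
    rw [norm_mul, Real.norm_of_nonneg (hnn q')]
    exact mul_le_mul_of_nonneg_left (hC _ ⟨_, rfl⟩) (hnn q')
  · refine hm.continuousAt.mul (hV.continuousAt.comp ?_)
    rw [Topology.IsInducing.subtypeVal.continuousAt_iff]
    refine tendsto_pi_nhds.2 fun a => ?_
    have hdiv : ContinuousAt (fun q : M.Belief t × M.Prescription 0 t × M.Prescription 1 t =>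
        R.joint t q.1 q.2.1 q.2.2 z a / R.marginal t q.1 q.2.1 q.2.2 z) q :=
      (R.continuous_joint t z a).continuousAt.div hm.continuousAt hpos.ne'
    have heq : ∀ q' : M.Belief t × M.Prescription 0 t × M.Prescription 1 t,
        0 < R.marginal t q'.1 q'.2.1 q'.2.2 z → R.joint t q'.1 q'.2.1 q'.2.2 z a /
          R.marginal t q'.1 q'.2.1 q'.2.2 z = (R.update K t q'.1 q'.2.1 q'.2.2 z).1 a := by
      intro q' h'
      rw [← R.marginal_mul_update K, mul_div_cancel_left₀ _ h'.ne']
    have hlim := hdiv.tendsto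
    rw [heq q hpos] at hlim
    exact hlim.congr' ((hm.continuousAt.eventually (lt_mem_nhds hpos)).mono heq)

theorem continuous_stageValue (t : ℕ) {V : M.Belief (t + 1) → ℝ} (hV : Continuous V) :
    Continuous fun q : M.Belief t × M.Prescription 0 t × M.Prescription 1 t =>
      R.stageValue K t V q.1 q.2.1 q.2.2 := by
  unfold stageValue
  refine Continuous.add ?_ (continuous_finsetSum _ fun z _ => R.continuous_marginal_mul K t z hV)
  unfold stageCost
  refine continuous_finsetSum _ fun x _ => continuous_finsetSum _ fun p₁ _ =>
    continuous_finsetSum _ fun p₂ _ => continuous_finsetSum _ fun u₁ _ =>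
    continuous_finsetSum _ fun u₂ _ => ?_
  simp only [mul_assoc (M.c _ _ _ _)]
  exact continuous_const.mul (continuous_weight t x p₁ p₂ u₁ u₂)

theorem continuous_minMaxDP (n t : ℕ) : Continuous (R.minMaxDP K n t) := by
  induction n generalizing t with
  | zero => exact continuous_const
  | succ n ih => exact continuous_minMax (R.continuous_stageValue K t (ih (t + 1)))

theorem continuous_swap_neg_stageValue (t : ℕ) {V : M.Belief (t + 1) → ℝ} (hV : Continuous V) :
    Continuous fun q : M.Belief t × M.Prescription 1 t × M.Prescription 0 t =>
      -R.stageValue K t V q.1 q.2.2 q.2.1 :=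
  ((R.continuous_stageValue K t hV).comp (by fun_prop :
    Continuous fun q : M.Belief t × M.Prescription 1 t × M.Prescription 0 t =>
      (q.1, q.2.2, q.2.1))).neg

theorem continuous_maxMinDP (n t : ℕ) : Continuous (R.maxMinDP K n t) := by
  induction n generalizing t with
  | zero => exact continuous_const
  | succ n ih =>
    have := (continuous_minMax (w := fun π γ₂ γ₁ =>
      -R.stageValue K t (R.maxMinDP K n (t + 1)) π γ₁ γ₂) (R.continuous_swap_neg_stageValue K t (ih (t + 1)))).neg
    exact this.congr fun π => neg_iInf_iSup_neg fun γ₂ γ₁ =>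
      R.stageValue K t (R.maxMinDP K n (t + 1)) π γ₁ γ₂

theorem Vu_eq {t : ℕ} (ht : t < M.T) (π : M.Belief t) :
    R.Vu K t π = ⨅ γ₁, ⨆ γ₂, R.wu K t π γ₁ γ₂ := by
  unfold wu Vu
  rw [show M.T - t = M.T - (t + 1) + 1 by omega]
  rfl

theorem Vl_eq {t : ℕ} (ht : t < M.T) (π : M.Belief t) :
    R.Vl K t π = ⨆ γ₂, ⨅ γ₁, R.wl K t π γ₁ γ₂ := by
  unfold wl Vl
  rw [show M.T - t = M.T - (t + 1) + 1 by omega]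
  rfl

theorem exists_isMinMaxSelector : ∃ σ, R.IsMinMaxSelector K σ := by
  have (t : ℕ) : ∃ σ : M.Belief t → M.Prescription 0 t, Measurable σ ∧ ∀ π,
      IsGreatest (Set.range fun γ₂ => R.wu K t π (σ π) γ₂) (⨅ γ₁, ⨆ γ₂, R.wu K t π γ₁ γ₂) :=
    exists_measurable_minMax (R.continuous_stageValue K t (R.continuous_minMaxDP K _ (t + 1)))
  choose σ hσ hσ' using this
  exact ⟨σ, fun t ht => ⟨hσ t, fun π => R.Vu_eq K ht π ▸ hσ' t π⟩⟩

theorem exists_isMaxMinSelector : ∃ σ, R.IsMaxMinSelector K σ := by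
  have (t : ℕ) : ∃ σ : M.Belief t → M.Prescription 1 t, Measurable σ ∧ ∀ π,
      IsGreatest (Set.range fun γ₁ => -R.wl K t π γ₁ (σ π)) (⨅ γ₂, ⨆ γ₁, -R.wl K t π γ₁ γ₂) :=
    exists_measurable_minMax (w := fun π γ₂ γ₁ => -R.wl K t π γ₁ γ₂)
      (R.continuous_swap_neg_stageValue K t (R.continuous_maxMinDP K _ (t + 1)))
  choose σ hσ hσ' using this
  refine ⟨σ, fun t ht => ⟨hσ t, fun π => ?_⟩⟩
  rw [R.Vl_eq K ht π, ← neg_iInf_iSup_neg (fun γ₂ γ₁ => R.wl K t π γ₁ γ₂)]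
  obtain ⟨⟨γ, hγ⟩, h⟩ := hσ' t π
  refine ⟨⟨γ, by simp only at hγ ⊢; rw [← hγ, neg_neg]⟩, ?_⟩
  rintro _ ⟨γ', rfl⟩
  exact neg_le.1 (h ⟨γ', rfl⟩)

theorem exists_Vu_le {t : ℕ} (ht : t < M.T) (π : M.Belief t) (γ₁ : M.Prescription 0 t) :
    ∃ γ₂, R.Vu K t π ≤ R.wu K t π γ₁ γ₂ := by
  rw [R.Vu_eq K ht]
  exact exists_minMax_le (R.continuous_stageValue K t (R.continuous_minMaxDP K _ (t + 1))) π γ₁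

theorem exists_le_Vl {t : ℕ} (ht : t < M.T) (π : M.Belief t) (γ₂ : M.Prescription 1 t) :
    ∃ γ₁, R.wl K t π γ₁ γ₂ ≤ R.Vl K t π := by
  rw [R.Vl_eq K ht, ← neg_iInf_iSup_neg (fun γ₂ γ₁ => R.wl K t π γ₁ γ₂)]
  obtain ⟨γ₁, h⟩ := exists_minMax_le (w := fun π γ₂ γ₁ => -R.wl K t π γ₁ γ₂)
    (R.continuous_swap_neg_stageValue K t (R.continuous_maxMinDP K (M.T - (t + 1)) (t + 1))) π γ₂
  exact ⟨γ₁, le_neg.1 h⟩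

end GameModel.Primitives

/-! ### Finitely valued random variables and independence -/

section FiniteRV

variable {Ω S S' : Type*}

/-- `Y` takes finitely many values, and all events determined by `Y` belong to `m`. -/
def IsFiniteRV (m : MeasurableSpace Ω) (Y : Ω → S) : Prop :=
  (Set.range Y).Finite ∧ ∀ A : Set S, MeasurableSet[m] (Y ⁻¹' A)

namespace IsFiniteRV

variable {m m' : MeasurableSpace Ω} {Y : Ω → S}

theorem mono (hY : IsFiniteRV m Y) (h : m ≤ m') : IsFiniteRV m' Y :=
  ⟨hY.1, fun A => h _ (hY.2 A)⟩

theorem comp (hY : IsFiniteRV m Y) (g : S → S') : IsFiniteRV m fun ω => g (Y ω) := by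
  refine ⟨?_, fun A => hY.2 (g ⁻¹' A)⟩
  have := hY.1.image g
  rwa [← Set.range_comp] at this

theorem of_fibers (hfin : (Set.range Y).Finite) (h : ∀ s, MeasurableSet[m] (Y ⁻¹' {s})) :
    IsFiniteRV m Y := by
  refine ⟨hfin, fun A => ?_⟩
  have : Y ⁻¹' A = ⋃ s ∈ Set.range Y ∩ A, Y ⁻¹' {s} := by
    ext ω
    simp
  rw [this]
  exact MeasurableSet.biUnion (hfin.inter_of_left A).countable fun s _ => h s

/-- Adjoining a random variable whose definition depends on the value of the first one. -/
theorem bind {N : S → Ω → S'} (hY : IsFiniteRV m Y) (hN : ∀ s, IsFiniteRV m (N s)) :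
    IsFiniteRV m fun ω => (Y ω, N (Y ω) ω) := by
  refine of_fibers ((hY.1.biUnion fun s _ => (hN s).1.image (Prod.mk s)).subset ?_) ?_
  · rintro _ ⟨ω, rfl⟩
    exact Set.mem_biUnion ⟨ω, rfl⟩ ⟨_, ⟨ω, rfl⟩, rfl⟩
  · rintro ⟨s, b⟩
    -- On the event `Y = s` the second component is `N s`, so a fibre of the pair is an intersection
    -- of two events of `m`.
    convert (hY.2 {s}).inter ((hN s).2 {b}) using 1
    ext ω
    simp only [Set.mem_preimage, Set.mem_singleton_iff, Prod.mk.injEq, Set.mem_inter_iff]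
    exact and_congr_right fun h => by rw [h]

theorem prodMk {N : Ω → S'} (hY : IsFiniteRV m Y) (hN : IsFiniteRV m N) :
    IsFiniteRV m fun ω => (Y ω, N ω) :=
  hY.bind fun _ => hN

variable {mΩ : MeasurableSpace Ω} {μ : Measure Ω} [IsFiniteMeasure μ]

theorem integrable (hY : IsFiniteRV m Y) (hm : m ≤ mΩ) (Φ : S → ℝ) :
    Integrable (fun ω => Φ (Y ω)) μ :=
  have h := (hY.mono hm).comp Φ
  SimpleFunc.integrable_of_isFiniteMeasure ⟨fun ω => Φ (Y ω), fun x => h.2 {x}, h.1⟩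

theorem integral_eq_sum (hY : IsFiniteRV m Y) (hm : m ≤ mΩ) (Φ : S → ℝ) {F : Finset S}
    (hF : ∀ ω, Y ω ∈ F) : ∫ ω, Φ (Y ω) ∂μ = ∑ s ∈ F, μ.real {ω | Y ω = s} * Φ s := by
  classical
  have hms : ∀ s, MeasurableSet {ω | Y ω = s} := fun s => hm _ (hY.2 {s})
  have h : ∀ ω, Φ (Y ω) = ∑ s ∈ F, {ω | Y ω = s}.indicator (fun _ => Φ s) ω := fun ω => by
    simp [Set.indicator_apply, hF ω]
  simp only [h]
  rw [integral_finsetSum _ fun s _ => (integrable_const _).indicator (hms s)]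
  refine Finset.sum_congr rfl fun s _ => ?_
  rw [integral_indicator_const _ (hms s), smul_eq_mul]

/-- Averaging over a random variable that is independent of the past. -/
theorem integral_bind_of_indep {m₁ m₂ : MeasurableSpace Ω} [Fintype S'] {N : S → Ω → S'}
    (h₁ : m₁ ≤ mΩ) (h₂ : m₂ ≤ mΩ) (hI : Indep m₁ m₂ μ) (hY : IsFiniteRV m₁ Y)
    (hN : ∀ s, IsFiniteRV m₂ (N s)) (Φ : S → S' → ℝ) :
    ∫ ω, Φ (Y ω) (N (Y ω) ω) ∂μ = ∫ ω, ∑ b, μ.real {ω' | N (Y ω) ω' = b} * Φ (Y ω) b ∂μ := by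
  classical
  have hF : ∀ ω, Y ω ∈ hY.1.toFinset := fun ω => by simp
  have hYN := (hY.mono h₁).bind fun s => (hN s).mono h₂
  rw [hY.integral_eq_sum h₁ (fun s => ∑ b, μ.real {ω' | N s ω' = b} * Φ s b) hF,
    hYN.integral_eq_sum le_rfl (fun q => Φ q.1 q.2) (F := hY.1.toFinset ×ˢ Finset.univ)
      fun ω => Finset.mk_mem_product (hF ω) (Finset.mem_univ _), Finset.sum_product]
  refine Finset.sum_congr rfl fun s _ => ?_
  rw [Finset.mul_sum]
  refine Finset.sum_congr rfl fun b _ => ?_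
  rw [← mul_assoc]
  congr 1
  -- On `Y = s` the dependence of `N` on `Y` disappears, and independence factors the probability.
  have : {ω | (Y ω, N (Y ω) ω) = (s, b)} = (Y ⁻¹' {s}) ∩ (N s ⁻¹' {b}) := by
    ext ω
    simp only [Set.mem_ofPred_eq, Prod.mk.injEq, Set.mem_inter_iff, Set.mem_preimage,
      Set.mem_singleton_iff]
    exact and_congr_right fun h => by rw [h]
  rw [this, measureReal_def, (Indep_iff _ _ _).1 hI _ _ (hY.2 {s}) ((hN s).2 {b}),
    ENNReal.toReal_mul]
  rfl

end IsFiniteRV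

end FiniteRV

/-! ### Dependence of the play on the primitive random variables -/

namespace GameModel.Primitives

variable {M : GameModel} {Ω : Type*} [MeasurableSpace Ω] {μ : Measure Ω} (R : M.Primitives μ)
  (K : M.Fallback)

/-- The σ-algebra generated by a set of primitive random variables. -/
abbrev sigma (S : Set (PrimIdx M.T)) : MeasurableSpace Ω :=
  ⨆ k ∈ S, MeasurableSpace.comap (primRV R.X₀ R.Ws R.W R.V k) inferInstance

theorem sigma_mono {S S' : Set (PrimIdx M.T)} (h : S ⊆ S') : R.sigma S ≤ R.sigma S' :=
  biSup_mono h

theorem sigma_le (S : Set (PrimIdx M.T)) : R.sigma S ≤ ‹MeasurableSpace Ω› :=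
  iSup₂_le fun k _ => (R.measurable_primRV k).comap_le

theorem indep_sigma {S S' : Set (PrimIdx M.T)} (h : Disjoint S S') :
    Indep (R.sigma S) (R.sigma S') μ :=
  indep_iSup_of_disjoint (fun k => (R.measurable_primRV k).comap_le) R.indep h

theorem measurableSet_sigma {S : Set (PrimIdx M.T)} {k : PrimIdx M.T} (hk : k ∈ S)
    {A : Set (M.PrimVal k)} (hA : MeasurableSet A) :
    MeasurableSet[R.sigma S] (primRV R.X₀ R.Ws R.W R.V k ⁻¹' A) :=
  le_iSup₂ (f := fun k (_ : k ∈ S) =>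
    MeasurableSpace.comap (primRV R.X₀ R.Ws R.W R.V k) inferInstance) k hk _ ⟨A, hA, rfl⟩

theorem isFiniteRV_X₀ {S : Set (PrimIdx M.T)} (h : PrimIdx.x₀ ∈ S) :
    IsFiniteRV (R.sigma S) R.X₀ :=
  ⟨Set.toFinite _, fun _ => R.measurableSet_sigma h trivial⟩

theorem isFiniteRV_Ws {S : Set (PrimIdx M.T)} {t : ℕ} (ht : t < M.T)
    (h : PrimIdx.ws ⟨t, ht⟩ ∈ S) : IsFiniteRV (R.sigma S) (R.Ws t) :=
  ⟨Set.toFinite _, fun _ => R.measurableSet_sigma h trivial⟩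

theorem isFiniteRV_W {S : Set (PrimIdx M.T)} {i : Fin 2} {t : ℕ} (ht : t < M.T)
    (h : PrimIdx.w i ⟨t, ht⟩ ∈ S) : IsFiniteRV (R.sigma S) (R.W i t) :=
  ⟨Set.toFinite _, fun _ => R.measurableSet_sigma h trivial⟩

theorem isFiniteRV_κ {S : Set (PrimIdx M.T)} {i : Fin 2} {t : ℕ} (ht : t < M.T)
    (h : PrimIdx.v i ⟨t, ht⟩ ∈ S) (p : stdSimplex ℝ (M.U i t)) :
    IsFiniteRV (R.sigma S) fun ω => M.κ i t p (R.V i t ω) :=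
  .of_fibers (Set.toFinite _) fun u => R.measurableSet_sigma h (M.measurableSet_κ i t p u)

/-- The primitive random variables that determine the play before the decisions at time `t`. -/
def past (M : GameModel) (t : ℕ) : Set (PrimIdx M.T) := fun
  | .x₀ => True
  | .ws s => s.1 < t
  -- Observations of time `t` precede the decisions of time `t`, hence `≤` here and `<` for system
  -- noise and randomization.
  | .w _ s => s.1 ≤ t
  | .v _ s => s.1 < t

/-- The randomization variables of time `t`. -/
def randomization (M : GameModel) (t : ℕ) : Set (PrimIdx M.T) := fun
  | .v _ s => s.1 = t
  | _ => False

/-- The noise variables of the transition after the decisions at time `t`. -/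
def noise (M : GameModel) (t : ℕ) : Set (PrimIdx M.T) := fun
  | .ws s => s.1 = t
  | .w _ s => s.1 = t + 1
  | _ => False

theorem disjoint_past_randomization (t : ℕ) : Disjoint (past M t) (randomization M t) := by
  refine Set.disjoint_left.2 fun k h h' => ?_
  cases k with
  | x₀ => exact h'
  | ws s => exact h'
  | w i s => exact h'
  | v i s => exact (ne_of_lt h) h'

theorem disjoint_decided_noise (t : ℕ) :
    Disjoint (past M t ∪ randomization M t) (noise M t) := by
  refine Set.disjoint_left.2 fun k h h' => ?_
  cases k with
  | x₀ => exact h'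
  | ws s => exact h.elim (fun h => (ne_of_lt h) h') id
  | w i s => exact h.elim (fun h => (ne_of_lt (Nat.lt_succ_of_le h)) h') id
  | v i s => exact h'

theorem past_succ (t : ℕ) :
    (past M t ∪ randomization M t) ∪ noise M t ⊆ past M (t + 1) := by
  intro k h
  cases k with
  | x₀ => trivial
  | ws s =>
    rcases h with (h | h) | h
    · exact Nat.lt_succ_of_lt h
    · exact h.elim
    · exact Nat.lt_succ_of_le (le_of_eq h)
  | w i s =>
    rcases h with (h | h) | h
    · exact Nat.le_succ_of_le h
    · exact h.elim
    · exact le_of_eq h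
  | v i s =>
    rcases h with (h | h) | h
    · exact Nat.lt_succ_of_lt h
    · exact Nat.lt_succ_of_le (le_of_eq h)
    · exact h.elim

/-- The play before the transition at time `t`: snapshot and actions. -/
def decided (χ₁ : M.Strategy 0) (χ₂ : M.Strategy 1) (t : ℕ) (ω : Ω) :
    M.Snapshot t × M.U 0 t × M.U 1 t :=
  (R.process χ₁ χ₂ ω t, R.action₁ χ₁ χ₂ t ω, R.action₂ χ₁ χ₂ t ω)

/-- The next state and private informations with the next information of the virtual players. -/
def _root_.GameModel.Snapshot.next {t : ℕ} (χ₁ : M.Strategy 0) (χ₂ : M.Strategy 1)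
    (s : M.Snapshot t)
    (n : M.Z (t + 1) × M.X (t + 1) × M.P 0 (t + 1) × M.P 1 (t + 1)) : M.Snapshot (t + 1) :=
  ⟨n.2.1, n.2.2.1, n.2.2.2, .step s.hist (χ₁ t s.hist) (χ₂ t s.hist) n.1⟩

theorem isFiniteRV_initial (ht : 0 < M.T) :
    IsFiniteRV (R.sigma (past M 0)) fun ω => (R.initial ω, R.initialCommon ω) :=
  (((R.isFiniteRV_X₀ (S := past M 0) trivial).prodMk
    ((R.isFiniteRV_W (i := 0) ht (le_refl 0)).prodMk (R.isFiniteRV_W (i := 1) ht (le_refl 0)))).comp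
      fun q : M.X 0 × M.W 0 0 × M.W 1 0 =>
        ((q.1, M.ξ₀ 0 (M.h₀ 0 q.1 q.2.1) (M.h₀ 1 q.1 q.2.2),
          M.ξ₀ 1 (M.h₀ 0 q.1 q.2.1) (M.h₀ 1 q.1 q.2.2)),
          M.ζ₀ (M.h₀ 0 q.1 q.2.1) (M.h₀ 1 q.1 q.2.2)))

/-- The transition uses the observation noises of time `t + 1`, which are labelled primitives only
before the horizon; hence the bound on `t + 1`. -/
theorem isFiniteRV_next {t : ℕ} (ht : t + 1 < M.T) (x : M.X t) (p₁ : M.P 0 t) (p₂ : M.P 1 t)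
    (u₁ : M.U 0 t) (u₂ : M.U 1 t) :
    IsFiniteRV (R.sigma (noise M t)) (R.next t x p₁ p₂ u₁ u₂) :=
  (((R.isFiniteRV_Ws (S := noise M t) (t := t) (by omega) rfl).prodMk
    ((R.isFiniteRV_W (S := noise M t) (i := 0) ht rfl).prodMk
      (R.isFiniteRV_W (S := noise M t) (i := 1) ht rfl))).comp
      fun q : M.Ws t × M.W 0 (t + 1) × M.W 1 (t + 1) =>
        (M.ζ t p₁ p₂ u₁ u₂ (M.h 0 t (M.f t x u₁ u₂ q.1) u₁ u₂ q.2.1)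
          (M.h 1 t (M.f t x u₁ u₂ q.1) u₁ u₂ q.2.2), M.f t x u₁ u₂ q.1,
          M.ξ 0 t p₁ u₁ (M.h 0 t (M.f t x u₁ u₂ q.1) u₁ u₂ q.2.1),
          M.ξ 1 t p₂ u₂ (M.h 1 t (M.f t x u₁ u₂ q.1) u₁ u₂ q.2.2)))

variable (χ₁ : M.Strategy 0) (χ₂ : M.Strategy 1)

theorem isFiniteRV_actions {t : ℕ} (ht : t < M.T) (s : M.Snapshot t) :
    IsFiniteRV (R.sigma (randomization M t)) fun ω =>
      (M.κ 0 t (χ₁ t s.hist s.p₁) (R.V 0 t ω), M.κ 1 t (χ₂ t s.hist s.p₂) (R.V 1 t ω)) :=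
  (R.isFiniteRV_κ (S := randomization M t) (i := 0) ht rfl (χ₁ t s.hist s.p₁)).prodMk
    (R.isFiniteRV_κ (S := randomization M t) (i := 1) ht rfl (χ₂ t s.hist s.p₂))

theorem isFiniteRV_decided_of_process {t : ℕ} (ht : t < M.T)
    (h : IsFiniteRV (R.sigma (past M t)) fun ω => R.process χ₁ χ₂ ω t) :
    IsFiniteRV (R.sigma (past M t ∪ randomization M t)) (R.decided χ₁ χ₂ t) :=
  (h.mono (R.sigma_mono Set.subset_union_left)).bind fun s =>
    (R.isFiniteRV_actions χ₁ χ₂ ht s).mono (R.sigma_mono Set.subset_union_right)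

/-- Each snapshot determines the prescriptions, after which only finitely many actions and
transitions are possible. Finiteness of the range takes the place of measurability of the
strategies. -/
theorem isFiniteRV_process {t : ℕ} (ht : t < M.T) :
    IsFiniteRV (R.sigma (past M t)) fun ω => R.process χ₁ χ₂ ω t := by
  induction t with
  | zero =>
    exact (R.isFiniteRV_initial ht).comp fun q => (⟨q.1.1, q.1.2.1, q.1.2.2, .start q.2⟩ :
      M.Snapshot 0)
  | succ t ih =>
    have h := R.isFiniteRV_decided_of_process χ₁ χ₂ (by omega) (ih (by omega))
    have := ((h.mono (R.sigma_mono Set.subset_union_left)).bind fun s =>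
      (R.isFiniteRV_next ht s.1.x s.1.p₁ s.1.p₂ s.2.1 s.2.2).mono
        (R.sigma_mono Set.subset_union_right)).mono (R.sigma_mono (past_succ t))
    exact this.comp fun q => q.1.1.next χ₁ χ₂ q.2

theorem isFiniteRV_decided {t : ℕ} (ht : t < M.T) :
    IsFiniteRV (R.sigma (past M t ∪ randomization M t)) (R.decided χ₁ χ₂ t) :=
  R.isFiniteRV_decided_of_process χ₁ χ₂ ht (R.isFiniteRV_process χ₁ χ₂ ht)

theorem measureReal_κ {i : Fin 2} {t : ℕ} (ht : t < M.T) (p : stdSimplex ℝ (M.U i t))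
    (u : M.U i t) : μ.real {ω | M.κ i t p (R.V i t ω) = u} = p.1 u := by
  have hV : Measurable (R.V i t) := R.measurable_primRV (.v i ⟨t, ht⟩)
  have := M.volume_κ i t p u
  rw [← R.uniform i ⟨t, ht⟩, Measure.map_apply hV (M.measurableSet_κ i t p u)] at this
  rw [measureReal_def]
  exact (congrArg ENNReal.toReal this).trans (ENNReal.toReal_ofReal (p.2.1 u))

theorem measureReal_actions {t : ℕ} (ht : t < M.T) (p₁ : stdSimplex ℝ (M.U 0 t))
    (p₂ : stdSimplex ℝ (M.U 1 t)) (u : M.U 0 t × M.U 1 t) :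
    μ.real {ω | (M.κ 0 t p₁ (R.V 0 t ω), M.κ 1 t p₂ (R.V 1 t ω)) = u} =
      p₁.1 u.1 * p₂.1 u.2 := by
  have hd : Disjoint ({PrimIdx.v 0 ⟨t, ht⟩} : Set (PrimIdx M.T)) {PrimIdx.v 1 ⟨t, ht⟩} := by simp
  have := (Indep_iff _ _ _).1 (R.indep_sigma hd) _ _
    ((R.isFiniteRV_κ (S := {PrimIdx.v 0 ⟨t, ht⟩}) ht rfl p₁).2 {u.1})
    ((R.isFiniteRV_κ (S := {PrimIdx.v 1 ⟨t, ht⟩}) ht rfl p₂).2 {u.2})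
  rw [← R.measureReal_κ ht, ← R.measureReal_κ ht, measureReal_def, measureReal_def,
    measureReal_def, ← ENNReal.toReal_mul]
  refine congrArg ENNReal.toReal (Eq.trans (congrArg μ ?_) this)
  ext ω
  simp [Prod.ext_iff]

theorem joint_eq (t : ℕ) (π : M.Belief t) (γ₁ : M.Prescription 0 t) (γ₂ : M.Prescription 1 t)
    (z : M.Z (t + 1)) (a' : M.X (t + 1) × M.P 0 (t + 1) × M.P 1 (t + 1)) :
    R.joint t π γ₁ γ₂ z a' = ∑ a : M.X t × M.P 0 t × M.P 1 t, ∑ u : M.U 0 t × M.U 1 t,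
      π.1 a * ((γ₁ a.2.1).1 u.1 * (γ₂ a.2.2).1 u.2) *
        R.transition t a.1 a.2.1 a.2.2 u.1 u.2 z a' := by
  simp only [joint, Fintype.sum_prod_type, mul_assoc]

theorem Vu_horizon : R.Vu K M.T = 0 := by
  unfold Vu
  rw [Nat.sub_self]
  rfl

theorem Vl_horizon : R.Vl K M.T = 0 := by
  unfold Vl
  rw [Nat.sub_self]
  rfl

/-! ### The belief as conditional law, and the telescoped cost -/

variable [IsFiniteMeasure μ]

/-- The randomization variables of time `t` are independent of the past, so given the snapshot the
actions follow the product of the prescribed laws. -/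
theorem integral_decided {t : ℕ} (ht : t < M.T)
    (Φ : M.Snapshot t → M.U 0 t × M.U 1 t → ℝ) :
    ∫ ω, Φ (R.process χ₁ χ₂ ω t) (R.action₁ χ₁ χ₂ t ω, R.action₂ χ₁ χ₂ t ω) ∂μ =
      ∫ ω, (fun s : M.Snapshot t => ∑ u : M.U 0 t × M.U 1 t,
        (χ₁ t s.hist s.p₁).1 u.1 * (χ₂ t s.hist s.p₂).1 u.2 * Φ s u) (R.process χ₁ χ₂ ω t) ∂μ := by
  have := IsFiniteRV.integral_bind_of_indep (R.sigma_le _) (R.sigma_le _)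
    (R.indep_sigma (disjoint_past_randomization t)) (R.isFiniteRV_process χ₁ χ₂ ht)
    (R.isFiniteRV_actions χ₁ χ₂ ht) Φ
  simp only [R.measureReal_actions ht] at this
  exact this

theorem integral_process_succ {t : ℕ} (ht : t + 1 < M.T) (Φ : M.Snapshot (t + 1) → ℝ) :
    ∫ ω, Φ (R.process χ₁ χ₂ ω (t + 1)) ∂μ =
      ∫ ω, (fun (s : M.Snapshot t) (u : M.U 0 t × M.U 1 t) =>
        ∑ n : M.Z (t + 1) × M.X (t + 1) × M.P 0 (t + 1) × M.P 1 (t + 1),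
          R.transition t s.x s.p₁ s.p₂ u.1 u.2 n.1 n.2 * Φ (s.next χ₁ χ₂ n))
        (R.process χ₁ χ₂ ω t) (R.action₁ χ₁ χ₂ t ω, R.action₂ χ₁ χ₂ t ω) ∂μ :=
  IsFiniteRV.integral_bind_of_indep (R.sigma_le _) (R.sigma_le _)
    (R.indep_sigma (disjoint_decided_noise t)) (R.isFiniteRV_decided χ₁ χ₂ (by omega))
    (fun s => R.isFiniteRV_next ht s.1.x s.1.p₁ s.1.p₂ s.2.1 s.2.2)
    fun s n => Φ (s.1.next χ₁ χ₂ n)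

/-- State and private informations of a snapshot. -/
def _root_.GameModel.Snapshot.hidden {t : ℕ} (s : M.Snapshot t) : M.X t × M.P 0 t × M.P 1 t :=
  (s.x, s.p₁, s.p₂)

/-- The belief is the conditional distribution of state and private informations given the
information of the virtual players. -/
def IsFilter (t : ℕ) : Prop :=
  ∀ Φ : M.Hist t → M.X t × M.P 0 t × M.P 1 t → ℝ,
    ∫ ω, Φ (R.process χ₁ χ₂ ω t).hist (R.process χ₁ χ₂ ω t).hidden ∂μ =
      ∫ ω, (fun k : M.Hist t => ∑ a, (R.belief K k).1 a * Φ k a) (R.process χ₁ χ₂ ω t).hist ∂μ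

-- Given the history, both prescriptions are fixed; averaging over the belief, the actions and the
-- noise yields the unnormalized `joint`.
variable {χ₁ χ₂} in
theorem IsFilter.integral_succ {t : ℕ} (hF : R.IsFilter K χ₁ χ₂ t) (ht : t + 1 < M.T)
    (Φ : M.Hist (t + 1) → M.X (t + 1) × M.P 0 (t + 1) × M.P 1 (t + 1) → ℝ) :
    ∫ ω, Φ (R.process χ₁ χ₂ ω (t + 1)).hist (R.process χ₁ χ₂ ω (t + 1)).hidden ∂μ =
      ∫ ω, (fun k : M.Hist t => ∑ z, ∑ a', R.joint t (R.belief K k) (χ₁ t k) (χ₂ t k) z a' *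
        Φ (.step k (χ₁ t k) (χ₂ t k) z) a') (R.process χ₁ χ₂ ω t).hist ∂μ := by
  rw [R.integral_process_succ χ₁ χ₂ ht (fun s => Φ s.hist s.hidden)]
  refine (R.integral_decided χ₁ χ₂ (by omega) fun s u =>
    ∑ n : M.Z (t + 1) × M.X (t + 1) × M.P 0 (t + 1) × M.P 1 (t + 1),
      R.transition t s.x s.p₁ s.p₂ u.1 u.2 n.1 n.2 *
        Φ (s.next χ₁ χ₂ n).hist (s.next χ₁ χ₂ n).hidden).trans ?_
  refine (hF fun k a => ∑ u : M.U 0 t × M.U 1 t, (χ₁ t k a.2.1).1 u.1 * (χ₂ t k a.2.2).1 u.2 *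
    ∑ n : M.Z (t + 1) × M.X (t + 1) × M.P 0 (t + 1) × M.P 1 (t + 1),
      R.transition t a.1 a.2.1 a.2.2 u.1 u.2 n.1 n.2 *
        Φ (.step k (χ₁ t k) (χ₂ t k) n.1) n.2).trans ?_
  congr 1
  funext ω
  generalize (R.process χ₁ χ₂ ω t).hist = k
  dsimp only
  rw [← Fintype.sum_prod_type' (f := fun z a' => R.joint t (R.belief K k) (χ₁ t k) (χ₂ t k) z a' *
    Φ (.step k (χ₁ t k) (χ₂ t k) z) a')]
  simp only [joint_eq, Finset.mul_sum, Finset.sum_mul]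
  rw [Finset.sum_comm (s := Finset.univ (α := M.Z (t + 1) × _))]
  refine Finset.sum_congr rfl fun a _ => ?_
  rw [Finset.sum_comm]
  refine Finset.sum_congr rfl fun n _ => Finset.sum_congr rfl fun u _ => ?_
  ring

/-- Induction on time by Bayes' rule in product form, so that null events need no separate
treatment. -/
theorem isFilter {t : ℕ} (ht : t < M.T) : R.IsFilter K χ₁ χ₂ t := by
  induction t with
  | zero =>
    intro Φ
    have h := R.isFiniteRV_initial ht
    have e₁ := h.integral_eq_sum (μ := μ) (R.sigma_le _) (fun q => Φ (.start q.2) q.1)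
      (F := Finset.univ) fun _ => Finset.mem_univ _
    have e₂ := h.integral_eq_sum (μ := μ) (R.sigma_le _)
      (fun q => ∑ a, (R.initialBelief K q.2).1 a * Φ (.start q.2) a)
      (F := Finset.univ) fun _ => Finset.mem_univ _
    refine e₁.trans (Eq.trans ?_ e₂.symm)
    rw [Fintype.sum_prod_type_right, Fintype.sum_prod_type_right]
    refine Finset.sum_congr rfl fun z _ => ?_
    dsimp only
    rw [← Finset.sum_mul, Finset.mul_sum]
    refine Finset.sum_congr rfl fun a _ => ?_
    rw [← mul_assoc]
    congr 1
    simp only [Prod.mk.injEq]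
    exact (sum_mul_bayes (fun a => μ.real {ω | R.initial ω = a ∧ R.initialCommon ω = z})
      (fun _ => measureReal_nonneg) (K.G₀ z) a).symm
  | succ t ih =>
    intro Φ
    have ih := ih (by omega)
    -- Both sides are pulled back to time `t`: one with `Φ`, the other with its average under the
    -- new belief, a function of the history alone.
    rw [ih.integral_succ R K ht,
      ih.integral_succ R K ht fun k _ => ∑ a, (R.belief K k).1 a * Φ k a]
    congr 1
    funext ω
    refine Finset.sum_congr rfl fun z _ => ?_
    rw [← Finset.sum_mul, Finset.mul_sum]
    refine Finset.sum_congr rfl fun a _ => ?_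
    rw [← mul_assoc]
    congr 1
    exact (R.marginal_mul_update K t _ _ _ z a).symm

theorem integral_stageCost {t : ℕ} (ht : t < M.T) :
    ∫ ω, M.c t (R.process χ₁ χ₂ ω t).x (R.action₁ χ₁ χ₂ t ω) (R.action₂ χ₁ χ₂ t ω) ∂μ =
      ∫ ω, (fun k => M.stageCost t (R.belief K k) (χ₁ t k) (χ₂ t k))
        (R.process χ₁ χ₂ ω t).hist ∂μ := by
  rw [R.integral_decided χ₁ χ₂ ht fun s u => M.c t s.x u.1 u.2]
  refine (R.isFilter K χ₁ χ₂ ht fun k a => ∑ u : M.U 0 t × M.U 1 t,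
    (χ₁ t k a.2.1).1 u.1 * (χ₂ t k a.2.2).1 u.2 * M.c t a.1 u.1 u.2).trans ?_
  congr 1
  funext ω
  simp only [stageCost, Fintype.sum_prod_type, Finset.mul_sum]
  refine Finset.sum_congr rfl fun x _ => Finset.sum_congr rfl fun p₁ _ =>
    Finset.sum_congr rfl fun p₂ _ => Finset.sum_congr rfl fun u₁ _ =>
    Finset.sum_congr rfl fun u₂ _ => ?_
  ring

theorem integrable_hist {t : ℕ} (ht : t < M.T) (Φ : M.Hist t → ℝ) :
    Integrable (fun ω => Φ (R.process χ₁ χ₂ ω t).hist) μ :=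
  (R.isFiniteRV_process χ₁ χ₂ ht).integrable (R.sigma_le _) fun s => Φ s.hist

theorem integral_stageValue {t : ℕ} (ht : t < M.T) (V : M.Belief (t + 1) → ℝ)
    (hV : t + 1 = M.T → V = 0) :
    ∫ ω, (fun k => R.stageValue K t V (R.belief K k) (χ₁ t k) (χ₂ t k))
        (R.process χ₁ χ₂ ω t).hist ∂μ =
      ∫ ω, M.c t (R.process χ₁ χ₂ ω t).x (R.action₁ χ₁ χ₂ t ω) (R.action₂ χ₁ χ₂ t ω) ∂μ +
        ∫ ω, V (R.belief K (R.process χ₁ χ₂ ω (t + 1)).hist) ∂μ := by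
  rw [R.integral_stageCost K χ₁ χ₂ ht]
  unfold stageValue
  rw [integral_add (R.integrable_hist χ₁ χ₂ ht fun k =>
      M.stageCost t (R.belief K k) (χ₁ t k) (χ₂ t k))
    (R.integrable_hist χ₁ χ₂ ht fun k => ∑ z, R.marginal t (R.belief K k) (χ₁ t k) (χ₂ t k) z *
      V (R.update K t (R.belief K k) (χ₁ t k) (χ₂ t k) z))]
  congr 1
  -- The process at the horizon is not covered by the preceding lemmas; at the last stage `V = 0`
  -- makes both continuation terms vanish.
  rcases Nat.lt_or_ge (t + 1) M.T with h | h
  · rw [(R.isFilter K χ₁ χ₂ ht).integral_succ R K h fun k _ => V (R.belief K k)]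
    simp only [marginal, Finset.sum_mul]
    rfl
  · simp [hV (by omega)]

/-- The cost of a strategy profile as a reference value plus the one-stage deviations. -/
theorem cost_eq (V : ∀ t, M.Belief t → ℝ) (hV : V M.T = 0) :
    R.cost χ₁ χ₂ = ∫ ω, V 0 (R.initialCIB K ω) ∂μ + ∑ t ∈ Finset.range M.T,
      ∫ ω, (fun k => R.stageValue K t (V (t + 1)) (R.belief K k) (χ₁ t k) (χ₂ t k) -
        V t (R.belief K k)) (R.process χ₁ χ₂ ω t).hist ∂μ := by
  have hterm : ∀ t ∈ Finset.range M.T,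
      ∫ ω, (fun k => R.stageValue K t (V (t + 1)) (R.belief K k) (χ₁ t k) (χ₂ t k) -
        V t (R.belief K k)) (R.process χ₁ χ₂ ω t).hist ∂μ =
      ∫ ω, M.c t (R.process χ₁ χ₂ ω t).x (R.action₁ χ₁ χ₂ t ω) (R.action₂ χ₁ χ₂ t ω) ∂μ +
        (∫ ω, V (t + 1) (R.belief K (R.process χ₁ χ₂ ω (t + 1)).hist) ∂μ -
          ∫ ω, V t (R.belief K (R.process χ₁ χ₂ ω t).hist) ∂μ) := fun t ht => by
    have ht := Finset.mem_range.1 ht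
    have hV' : t + 1 = M.T → V (t + 1) = 0 := fun h => by rw [h]; exact hV
    rw [integral_sub (R.integrable_hist χ₁ χ₂ ht fun k =>
        R.stageValue K t (V (t + 1)) (R.belief K k) (χ₁ t k) (χ₂ t k))
      (R.integrable_hist χ₁ χ₂ ht fun k => V t (R.belief K k)),
      R.integral_stageValue K χ₁ χ₂ ht _ hV', add_sub_assoc]
  -- The `V` terms telescope; `V M.T = 0` removes the final one and leaves the value at the initial
  -- belief.
  rw [Finset.sum_congr rfl hterm, Finset.sum_add_distrib,
    Finset.sum_range_sub fun t => ∫ ω, V t (R.belief K (R.process χ₁ χ₂ ω t).hist) ∂μ, hV, cost,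
    integral_finsetSum]
  · change _ = ∫ ω, V 0 (R.belief K (R.process χ₁ χ₂ ω 0).hist) ∂μ + _
    simp
  · exact fun t ht => (R.isFiniteRV_decided χ₁ χ₂ (Finset.mem_range.1 ht)).integrable
      (R.sigma_le _) fun s => M.c t s.1.x s.2.1 s.2.2

/-! ### Verification bounds and the values of the game -/

variable {χ₁ χ₂}

theorem cost_le (V : ∀ t, M.Belief t → ℝ) (hV : V M.T = 0)
    (h : ∀ t < M.T, ∀ k : M.Hist t,
      R.stageValue K t (V (t + 1)) (R.belief K k) (χ₁ t k) (χ₂ t k) ≤ V t (R.belief K k)) :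
    R.cost χ₁ χ₂ ≤ ∫ ω, V 0 (R.initialCIB K ω) ∂μ := by
  rw [R.cost_eq K χ₁ χ₂ V hV]
  exact add_le_of_nonpos_right <| Finset.sum_nonpos fun t ht =>
    integral_nonpos fun ω => sub_nonpos.2 (h t (Finset.mem_range.1 ht) _)

theorem le_cost (V : ∀ t, M.Belief t → ℝ) (hV : V M.T = 0)
    (h : ∀ t < M.T, ∀ k : M.Hist t,
      V t (R.belief K k) ≤ R.stageValue K t (V (t + 1)) (R.belief K k) (χ₁ t k) (χ₂ t k)) :
    ∫ ω, V 0 (R.initialCIB K ω) ∂μ ≤ R.cost χ₁ χ₂ := by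
  rw [R.cost_eq K χ₁ χ₂ V hV]
  exact le_add_of_nonneg_right <| Finset.sum_nonneg fun t ht =>
    integral_nonneg fun ω => sub_nonneg.2 (h t (Finset.mem_range.1 ht) _)

/-- As `χ₁` is fixed before the reply, `χ₁ t k` is known at each history `k`, and player 2 can
answer it history by history; the choice need not be measurable. -/
theorem exists_le_cost (χ₁ : M.Strategy 0) :
    ∃ χ₂, ∫ ω, R.Vu K 0 (R.initialCIB K ω) ∂μ ≤ R.cost χ₁ χ₂ := by
  have (t : ℕ) (k : M.Hist t) : ∃ γ₂ : M.Prescription 1 t, t < M.T →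
      R.Vu K t (R.belief K k) ≤ R.wu K t (R.belief K k) (χ₁ t k) γ₂ := by
    rcases lt_or_ge t M.T with ht | ht
    · obtain ⟨γ₂, h⟩ := R.exists_Vu_le K ht (R.belief K k) (χ₁ t k)
      exact ⟨γ₂, fun _ => h⟩
    -- Prescriptions from the horizon on do not affect the cost.
    · exact ⟨Classical.arbitrary _, fun h => absurd h (not_lt.2 ht)⟩
  choose χ₂ h using this
  exact ⟨χ₂, R.le_cost K (R.Vu K) (R.Vu_horizon K) fun t ht k => h t k ht⟩

theorem exists_cost_le (χ₂ : M.Strategy 1) :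
    ∃ χ₁, R.cost χ₁ χ₂ ≤ ∫ ω, R.Vl K 0 (R.initialCIB K ω) ∂μ := by
  have (t : ℕ) (k : M.Hist t) : ∃ γ₁ : M.Prescription 0 t, t < M.T →
      R.wl K t (R.belief K k) γ₁ (χ₂ t k) ≤ R.Vl K t (R.belief K k) := by
    rcases lt_or_ge t M.T with ht | ht
    · obtain ⟨γ₁, h⟩ := R.exists_le_Vl K ht (R.belief K k) (χ₂ t k)
      exact ⟨γ₁, fun _ => h⟩
    · exact ⟨Classical.arbitrary _, fun h => absurd h (not_lt.2 ht)⟩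
  choose χ₁ h using this
  exact ⟨χ₁, R.cost_le K (R.Vl K) (R.Vl_horizon K) fun t ht k => h t k ht⟩

theorem le_upperValue :
    ((∫ ω, R.Vu K 0 (R.initialCIB K ω) ∂μ : ℝ) : EReal) ≤ R.upperValue :=
  le_iInf fun χ₁ =>
    let ⟨χ₂, h⟩ := R.exists_le_cost K χ₁
    (EReal.coe_le_coe_iff.2 h).trans (le_iSup (fun χ₂ => (R.cost χ₁ χ₂ : EReal)) χ₂)

theorem lowerValue_le :
    R.lowerValue ≤ ((∫ ω, R.Vl K 0 (R.initialCIB K ω) ∂μ : ℝ) : EReal) :=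
  iSup_le fun χ₂ =>
    let ⟨χ₁, h⟩ := R.exists_cost_le K χ₂
    (iInf_le (fun χ₁ => (R.cost χ₁ χ₂ : EReal)) χ₁).trans (EReal.coe_le_coe_iff.2 h)

/-- The selector property bounds `wu` for every `γ₂`, so no behaviour of player 2, even one
depending on the whole history, makes a one-stage defect positive. -/
theorem IsMinMaxSelector.iSup_cost_le {σ : ∀ t, M.Belief t → M.Prescription 0 t}
    (hσ : R.IsMinMaxSelector K σ) :
    ⨆ χ₂ : M.Strategy 1, (R.cost (R.beliefStrategy K σ) χ₂ : EReal) ≤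
      ((∫ ω, R.Vu K 0 (R.initialCIB K ω) ∂μ : ℝ) : EReal) :=
  iSup_le fun _ => EReal.coe_le_coe_iff.2 <| R.cost_le K (R.Vu K) (R.Vu_horizon K)
    fun t ht k => ((hσ t ht).2 (R.belief K k)).2 ⟨_, rfl⟩

theorem IsMaxMinSelector.le_iInf_cost {σ : ∀ t, M.Belief t → M.Prescription 1 t}
    (hσ : R.IsMaxMinSelector K σ) :
    ((∫ ω, R.Vl K 0 (R.initialCIB K ω) ∂μ : ℝ) : EReal) ≤
      ⨅ χ₁ : M.Strategy 0, (R.cost χ₁ (R.beliefStrategy K σ) : EReal) :=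
  le_iInf fun _ => EReal.coe_le_coe_iff.2 <| R.le_cost K (R.Vl K) (R.Vl_horizon K)
    fun t ht k => ((hσ t ht).2 (R.belief K k)).2 ⟨_, rfl⟩

theorem upperValue_eq :
    R.upperValue = ((∫ ω, R.Vu K 0 (R.initialCIB K ω) ∂μ : ℝ) : EReal) :=
  let ⟨_, hσ⟩ := R.exists_isMinMaxSelector K
  le_antisymm ((iInf_le _ _).trans (hσ.iSup_cost_le R K)) (R.le_upperValue K)

theorem lowerValue_eq :
    R.lowerValue = ((∫ ω, R.Vl K 0 (R.initialCIB K ω) ∂μ : ℝ) : EReal) :=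
  let ⟨_, hσ⟩ := R.exists_isMaxMinSelector K
  le_antisymm (R.lowerValue_le K) ((hσ.le_iInf_cost R K).trans
    (le_iSup (fun χ₂ => ⨅ χ₁, (R.cost χ₁ χ₂ : EReal)) _))

end GameModel.Primitives

theorem theorem2 (M : GameModel) {Ω : Type*} [MeasurableSpace Ω] (μ : Measure Ω)
    [IsProbabilityMeasure μ] (R : M.Primitives μ) (K : M.Fallback) :
    R.upperValue = ((∫ ω, R.Vu K 0 (R.initialCIB K ω) ∂μ : ℝ) : EReal) ∧
    R.lowerValue = ((∫ ω, R.Vl K 0 (R.initialCIB K ω) ∂μ : ℝ) : EReal) ∧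
    (∃ σ, R.IsMinMaxSelector K σ) ∧
    (∀ σ, R.IsMinMaxSelector K σ → R.IsMinMaxStrategy (R.beliefStrategy K σ)) ∧
    (∃ σ, R.IsMaxMinSelector K σ) ∧
    (∀ σ, R.IsMaxMinSelector K σ → R.IsMaxMinStrategy (R.beliefStrategy K σ)) := by
  refine ⟨R.upperValue_eq K, R.lowerValue_eq K, R.exists_isMinMaxSelector K, fun σ hσ => ?_,
    R.exists_isMaxMinSelector K, fun σ hσ => ?_⟩
  · exact le_antisymm ((hσ.iSup_cost_le R K).trans (R.upperValue_eq K).ge) (iInf_le _ _)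
  · exact le_antisymm (le_iSup (fun χ₂ => ⨅ χ₁, (R.cost χ₁ χ₂ : EReal)) _)
      ((R.lowerValue_eq K).le.trans (hσ.le_iInf_cost R K))
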